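/- Let $R$ be a commutative noetherian ring, let $\mathscr{S}$ be a Serre subcategory of the category of $R$-modules (a nonempty class of $R$-modules closed under submodules, quotient modules and extensions), and let $M$ be an arbitrary $R$-module. Let $I$ and $J$ be ideals of $R$ with $\sqrt{I}=\sqrt{J}$, and let $I=(x_1,\dots,x_r)$ and $J=(y_1,\dots,y_s)$ for arbitrary finite systems of generators. Denote by $K(I)$ and $K(J)$ the Koszul complexes of the sequences $x_1,\dots,x_r$ and $y_1,\dots,y_s$, and put $H_i(K(I),M)=H_i(K(I)\otimes_R M)$, and likewise for $J$. Then for every integer $n\geq 0$ the following assertions are equivalent: 1. $\operatorname{Tor}_i^R(R/I,M)\in\mathscr{S}$ for all $0\leq i\leq n$; 2. $\operatorname{Tor}_i^R(R/J,M)\in\mathscr{S}$ for all $0\leq i\leq n$; 3. $H_i(K(I),M)\in\mathscr{S}$ for all $0\leq i\leq n$; 4. $H_i(K(J),M)\in\mathscr{S}$ for all $0\leq i\leq n$. -/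

import Mathlib

open CategoryTheory

universe u

namespace Koszul

/-- The linear form `R^r → R` sending the `j`-th basis vector to `x j`. -/
def form {R : Type u} [CommRing R] {r : ℕ} (x : Fin r → R) : Module.Dual R (Fin r → R) :=
  Fintype.linearCombination R x

theorem form_single {R : Type u} [CommRing R] {r : ℕ} (x : Fin r → R) (j : Fin r) :
    form x (Pi.single j 1) = x j := by
  simp [form]

/-- Contraction with a linear form lowers the degree by one in the exterior algebra. -/
theorem contractLeft_mem {R : Type u} [CommRing R] {E : Type u} [AddCommGroup E] [Module R E]
    (f : Module.Dual R E) (n : ℕ) {a : ExteriorAlgebra R E} (ha : a ∈ ⋀[R]^(n + 1) E) :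
    CliffordAlgebra.contractLeft (Q := (0 : QuadraticForm R E)) f a ∈ ⋀[R]^n E := by
  induction n generalizing a with
  | zero =>
    have h : ⋀[R]^(0 + 1) E = LinearMap.range (ExteriorAlgebra.ι R (M := E)) := by
      rw [zero_add]; exact pow_one _
    rw [h] at ha
    obtain ⟨m, rfl⟩ := ha
    refine Submodule.mem_one.2 ⟨f m, ?_⟩
    exact (CliffordAlgebra.contractLeft_ι (Q := (0 : QuadraticForm R E)) (d := f) m).symm
  | succ n ih =>
    have h : ⋀[R]^(n + 1 + 1) E
        = LinearMap.range (ExteriorAlgebra.ι R (M := E)) * ⋀[R]^(n + 1) E := pow_succ' _ _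
    rw [h] at ha
    induction ha using Submodule.mul_induction_on' with
    | mem_mul_mem v hv b hb =>
      obtain ⟨m, rfl⟩ := hv
      have e := CliffordAlgebra.contractLeft_ι_mul (Q := (0 : QuadraticForm R E)) (d := f) m b
      have h2 : ⋀[R]^(n + 1) E
          = LinearMap.range (ExteriorAlgebra.ι R (M := E)) * ⋀[R]^n E := pow_succ' _ _
      have h3 : ExteriorAlgebra.ι R m *
          CliffordAlgebra.contractLeft (Q := (0 : QuadraticForm R E)) f b ∈ ⋀[R]^(n + 1) E := by
        rw [h2]
        exact Submodule.mul_mem_mul (LinearMap.mem_range_self _ m) (ih hb)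
      have h4 := Submodule.sub_mem _ (Submodule.smul_mem _ (f m) hb) h3
      exact e ▸ h4
    | add a _ b _ iha ihb =>
      rw [map_add]
      exact Submodule.add_mem _ iha ihb

/-- The Koszul differential `⋀^(n+1) R^r → ⋀^n R^r`, i.e. contraction with the form `e_j ↦ x_j`:
`v_0 ∧ ⋯ ∧ v_n ↦ ∑ i, (-1)^i f(v_i) v_0 ∧ ⋯ (omit v_i) ⋯ ∧ v_n`, where `f = form x`. -/
noncomputable def differential {R : Type u} [CommRing R] {r : ℕ} (x : Fin r → R) (n : ℕ) :
    ⋀[R]^(n + 1) (Fin r → R) →ₗ[R] ⋀[R]^n (Fin r → R) :=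
  (CliffordAlgebra.contractLeft (Q := (0 : QuadraticForm R (Fin r → R))) (form x)).restrict
    (fun _ ha => contractLeft_mem (form x) n ha)

theorem differential_comp {R : Type u} [CommRing R] {r : ℕ} (x : Fin r → R) (n : ℕ) :
    differential x n ∘ₗ differential x (n + 1) = 0 := by
  refine LinearMap.ext fun a => Subtype.ext ?_
  exact CliffordAlgebra.contractLeft_contractLeft (Q := (0 : QuadraticForm R (Fin r → R)))
    (d := form x) (a : ExteriorAlgebra R (Fin r → R))

/-- The Koszul complex `K(x_1, …, x_r)` of a finite sequence of elements of `R`. -/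
noncomputable def koszulComplex {R : Type u} [CommRing R] {r : ℕ} (x : Fin r → R) :
    ChainComplex (ModuleCat.{u} R) ℕ :=
  ChainComplex.of (fun n => ModuleCat.of R (⋀[R]^n (Fin r → R)))
    (fun n => ModuleCat.ofHom (differential x n))
    (fun n => by
      rw [← ModuleCat.ofHom_comp, differential_comp]
      rfl)

/-- The complex `K(x_1, …, x_r) ⊗ M`. -/
noncomputable def tensorComplex {R : Type u} [CommRing R] {r : ℕ} (x : Fin r → R)
    (M : ModuleCat.{u} R) : ChainComplex (ModuleCat.{u} R) ℕ :=
  ((MonoidalCategory.tensorRight M).mapHomologicalComplex (ComplexShape.down ℕ)).obj (koszulComplex x)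

/-- The Koszul homology `H_i(K(x_1, …, x_r), M) = H_i(K(x_1, …, x_r) ⊗ M)`. -/
noncomputable def koszulHomology {R : Type u} [CommRing R] {r : ℕ} (x : Fin r → R)
    (M : ModuleCat.{u} R) (i : ℕ) : ModuleCat.{u} R :=
  (tensorComplex x M).homology i

end Koszul

/-! Write Tor_i(N) for Tor_i(N, M). Two arguments carry the proof.

If Tor_j(R/I) ∈ S for all j ≤ i, then Tor_i(N) ∈ S for every finitely generated N killed by a power
of I (`torMem_of_pow_smul_eq_zero`). Since R is noetherian, some I^k lies in J, so N = R/J is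
allowed; by symmetry 1 ⇔ 2.

For 1 ⇔ 3 put C_n = K_n/B_n, where B_n is the module of boundaries and K_n is flat. The sequences 0
→ H_{n+1} → C_{n+1} → B_n → 0 and 0 → B_n → K_n → C_n → 0 link Tor_{j+1}(C_{n+1}) to Tor_{j+2}(C_n),
and H_{n+1}(K ⊗ M) to Tor_1(C_n), up to Tor of H_{n+1}. That error is controlled by Tor of R/I,
because I kills H_{n+1}. Since C_0 ≅ R/I, moving along n gives `homologyMem_of_torMem` and, with an
induction, `torMem_of_homologyMem`. -/

namespace Koszul

/-! ### Long exact sequence of Tor in the first variable -/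

section TorSequence

open MonoidalCategory

variable {R : Type u} [CommRing R]

/-- The functor `N ↦ N ⊗ P` for a fixed chain complex `P`. -/
noncomputable def tensorFunctor (P : ChainComplex (ModuleCat.{u} R) ℕ) :
    ModuleCat.{u} R ⥤ ChainComplex (ModuleCat.{u} R) ℕ where
  obj N := ((tensorLeft N).mapHomologicalComplex (ComplexShape.down ℕ)).obj P
  map f := (NatTrans.mapHomologicalComplex ((tensoringLeft _).map f)
    (ComplexShape.down ℕ)).app P
  map_id N := by ext; simp
  map_comp f g := by ext; simp

instance (P : ChainComplex (ModuleCat.{u} R) ℕ) : (tensorFunctor P).PreservesZeroMorphisms where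
  map_zero X Y := by
    ext n : 1
    change (0 : X ⟶ Y) ▷ P.X n = 0
    simp

theorem shortExact_map_tensorFunctor {P : ChainComplex (ModuleCat.{u} R) ℕ}
    (hP : ∀ n, Module.Flat R (P.X n)) {E : ShortComplex (ModuleCat.{u} R)} (hE : E.ShortExact) :
    (E.map (tensorFunctor P)).ShortExact := by
  refine HomologicalComplex.shortExact_of_degreewise_shortExact _ fun i => ?_
  exact hE.map_of_exact (tensorRight (P.X i))

theorem flat_projectiveResolution {M : ModuleCat.{u} R} (P : ProjectiveResolution M) (n : ℕ) :
    Module.Flat R (P.complex.X n) :=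
  have : Module.Projective R (P.complex.X n) :=
    (IsProjective.iff_projective (P.complex.X n)).2 (P.projective n)
  inferInstance

/-- `Tor` computed from a projective resolution of the second variable. -/
noncomputable def torIso {M : ModuleCat.{u} R} (P : ProjectiveResolution M) (N : ModuleCat.{u} R)
    (i : ℕ) : ((Tor (ModuleCat.{u} R) i).obj N).obj M ≅
      ((tensorFunctor P.complex).obj N).homology i :=
  P.isoLeftDerivedObj (tensorLeft N) i

theorem opcyclesMap_comp_fromLeftDerivedZero' {C D : Type*} [Category* C] [Category* D]
    [Abelian C] [Abelian D] {F G : C ⥤ D} [F.Additive] [G.Additive] (α : F ⟶ G) {X : C}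
    (P : ProjectiveResolution X) :
    HomologicalComplex.opcyclesMap ((NatTrans.mapHomologicalComplex α _).app P.complex) 0 ≫
      P.fromLeftDerivedZero' G = P.fromLeftDerivedZero' F ≫ α.app X := by
  rw [← cancel_epi (HomologicalComplex.pOpcycles _ _), HomologicalComplex.p_opcyclesMap_assoc,
    ProjectiveResolution.pOpcycles_comp_fromLeftDerivedZero',
    ProjectiveResolution.pOpcycles_comp_fromLeftDerivedZero'_assoc]
  exact (α.naturality _).symm

instance isIso_fromLeftDerivedZero' {M : ModuleCat.{u} R} (P : ProjectiveResolution M)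
    (N : ModuleCat.{u} R) : IsIso (P.fromLeftDerivedZero' (tensorLeft N)) := by
  have : Limits.PreservesFiniteColimits (tensorLeft N) := inferInstance
  infer_instance

/-- The isomorphism `H_0(N ⊗ P) ≅ N ⊗ M` for a projective resolution `P` of `M`. -/
noncomputable def homologyZeroIso {M : ModuleCat.{u} R} (P : ProjectiveResolution M)
    (N : ModuleCat.{u} R) : ((tensorFunctor P.complex).obj N).homology 0 ≅ N ⊗ M :=
  ChainComplex.isoHomologyι₀
    (((tensorLeft N).mapHomologicalComplex (ComplexShape.down ℕ)).obj P.complex) ≪≫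
    @asIso _ _ _ _ _ (isIso_fromLeftDerivedZero' P N)

/-- Lets `torMem_one_iff` replace the map induced on H_0 by `f.rTensor M`. -/
theorem homologyZeroIso_naturality {M : ModuleCat.{u} R} (P : ProjectiveResolution M)
    {N N' : ModuleCat.{u} R} (f : N ⟶ N') :
    HomologicalComplex.homologyMap ((tensorFunctor P.complex).map f) 0 ≫
      (homologyZeroIso P N').hom = (homologyZeroIso P N).hom ≫ f ▷ M :=
  (HomologicalComplex.homologyι_naturality_assoc
    ((tensorFunctor P.complex).map f) 0 _).trans <|
    (congrArg (_ ≫ ·) (opcyclesMap_comp_fromLeftDerivedZero'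
      (F := tensorLeft N) (G := tensorLeft N') ((tensoringLeft _).map f) P)).trans
      (Category.assoc _ _ _).symm

variable (S : ObjectProperty (ModuleCat.{u} R)) (M : ModuleCat.{u} R)

/-- The assertion that `Tor_i(N, M)` belongs to `S`. -/
def TorMem (i : ℕ) (N : Type u) [AddCommGroup N] [Module R N] : Prop :=
  S (((Tor (ModuleCat.{u} R) i).obj (ModuleCat.of R N)).obj M)

variable [S.IsSerreClass] {S M}
variable {A B C : Type u} [AddCommGroup A] [AddCommGroup B] [AddCommGroup C] [Module R A]
  [Module R B] [Module R C] {f : A →ₗ[R] B} {g : B →ₗ[R] C}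

theorem torMem_iff (P : ProjectiveResolution M) (i : ℕ) :
    TorMem S M i A ↔ S (((tensorFunctor P.complex).obj (ModuleCat.of R A)).homology i) :=
  S.prop_iff_of_iso (torIso P _ i)

theorem TorMem.congr (e : A ≃ₗ[R] B) {i : ℕ} (h : TorMem S M i A) : TorMem S M i B :=
  S.prop_of_iso (((Tor (ModuleCat.{u} R) i).mapIso e.toModuleIso).app M) h

theorem shortExact_tensorFunctor (P : ProjectiveResolution M) (hf : Function.Injective f)
    (hg : Function.Surjective g) (hfg : Function.Exact f g) :
    ((ModuleCat.shortComplexOfCompEqZero f g hfg.linearMap_comp_eq_zero).map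
      (tensorFunctor P.complex)).ShortExact :=
  shortExact_map_tensorFunctor (flat_projectiveResolution P)
    (ModuleCat.shortComplex_shortExact _ hfg hf hg)

theorem TorMem.middle (hf : Function.Injective f) (hg : Function.Surjective g)
    (hfg : Function.Exact f g) {i : ℕ} (hA : TorMem S M i A) (hC : TorMem S M i C) :
    TorMem S M i B := by
  let P := projectiveResolution M
  rw [torMem_iff P] at *
  exact S.prop_X₂_of_exact ((shortExact_tensorFunctor P hf hg hfg).homology_exact₂ i) hA hC

theorem TorMem.right_succ (hf : Function.Injective f) (hg : Function.Surjective g)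
    (hfg : Function.Exact f g) {i : ℕ} (hB : TorMem S M (i + 1) B) (hA : TorMem S M i A) :
    TorMem S M (i + 1) C := by
  let P := projectiveResolution M
  rw [torMem_iff P] at *
  exact S.prop_X₂_of_exact
    ((shortExact_tensorFunctor P hf hg hfg).homology_exact₃ (i + 1) i rfl) hB hA

theorem TorMem.left (hf : Function.Injective f) (hg : Function.Surjective g)
    (hfg : Function.Exact f g) {i : ℕ} (hC : TorMem S M (i + 1) C) (hB : TorMem S M i B) :
    TorMem S M i A := by
  let P := projectiveResolution M
  rw [torMem_iff P] at *
  exact S.prop_X₂_of_exact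
    ((shortExact_tensorFunctor P hf hg hfg).homology_exact₁ (i + 1) i rfl) hC hB

theorem torMem_zero_iff : TorMem S M 0 A ↔ S (ModuleCat.of R (TensorProduct R A M)) := by
  rw [torMem_iff (projectiveResolution M)]
  exact S.prop_iff_of_iso (homologyZeroIso (projectiveResolution M) (ModuleCat.of R A))

theorem prop_of_surjective (hg : Function.Surjective g) (hB : S (ModuleCat.of R B)) :
    S (ModuleCat.of R C) :=
  have : Epi (ModuleCat.ofHom g) := (ModuleCat.epi_iff_surjective _).2 hg
  S.prop_of_epi (ModuleCat.ofHom g) hB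

theorem prop_of_exact (hfg : Function.Exact f g) (hA : S (ModuleCat.of R A))
    (hC : S (ModuleCat.of R C)) : S (ModuleCat.of R B) :=
  S.prop_X₂_of_exact (ModuleCat.shortComplex_exact
    (ModuleCat.shortComplexOfCompEqZero f g hfg.linearMap_comp_eq_zero) hfg) hA hC

theorem TorMem.right_zero (hg : Function.Surjective g) (hB : TorMem S M 0 B) :
    TorMem S M 0 C := by
  rw [torMem_zero_iff] at *
  exact prop_of_surjective (LinearMap.rTensor_surjective M hg) hB

theorem isZero_homology_of_flat [Module.Flat R B] (P : ProjectiveResolution M) (i : ℕ) :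
    Limits.IsZero (((tensorFunctor P.complex).obj (ModuleCat.of R B)).homology (i + 1)) := by
  have h : (P.complex.sc (i + 1)).Exact := P.complex_exactAt_succ i
  have h' := Module.Flat.lTensor_shortComplex_exact (ModuleCat.of R B) _ h
  exact ShortComplex.exact_iff_isZero_homology _ |>.1 h'

theorem torMem_succ_of_flat [Module.Flat R B] (i : ℕ) : TorMem S M (i + 1) B := by
  rw [torMem_iff (projectiveResolution M)]
  exact S.prop_of_isZero (isZero_homology_of_flat _ i)

/-- Tor_1(B) = 0 makes the connecting map Tor_1(C) → A ⊗ M a kernel of A ⊗ M → B ⊗ M. -/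
theorem torMem_one_iff [Module.Flat R B] (hf : Function.Injective f)
    (hg : Function.Surjective g) (hfg : Function.Exact f g) :
    TorMem S M 1 C ↔ S (ModuleCat.of R (LinearMap.ker (f.rTensor M))) := by
  let P := projectiveResolution M
  rw [torMem_iff P]
  have hE := shortExact_tensorFunctor P hf hg hfg
  have : Mono (hE.δ 1 0 rfl) := hE.mono_δ 1 0 rfl (isZero_homology_of_flat (B := B) P 0)
  have hK := (hE.homology_exact₁ 1 0 rfl).fIsKernel
  let e : ((tensorFunctor P.complex).obj (ModuleCat.of R C)).homology 1 ≅
      ModuleCat.of R (LinearMap.ker (f.rTensor M)) := by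
    refine (Limits.IsLimit.conePointUniqueUpToIso hK (Limits.kernelIsKernel _)) ≪≫
      Limits.kernel.mapIso _ (ModuleCat.ofHom (f.rTensor M)) (homologyZeroIso P (ModuleCat.of R A))
        (homologyZeroIso P (ModuleCat.of R B)) (homologyZeroIso_naturality P _) ≪≫
      ModuleCat.kernelIsoKer (ModuleCat.ofHom (f.rTensor M))
  exact S.prop_iff_of_iso e

end TorSequence

/-! ### Tor of finitely generated modules killed by a power of I -/

section Annihilated

variable {R : Type u} [CommRing R] {S : ObjectProperty (ModuleCat.{u} R)} [S.IsSerreClass]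
  {M : ModuleCat.{u} R}

theorem torMem_of_subsingleton (i : ℕ) (N : Type u) [AddCommGroup N] [Module R N]
    [Subsingleton N] : TorMem S M i N := by
  cases i with
  | zero =>
    rw [torMem_zero_iff]
    exact S.prop_of_isZero (ModuleCat.isZero_of_subsingleton _)
  | succ i =>
    exact torMem_succ_of_flat i

theorem torMem_fin_fun {N : Type u} [AddCommGroup N] [Module R N] {i : ℕ}
    (h : TorMem S M i N) (k : ℕ) : TorMem S M i (Fin k → N) := by
  induction k with
  | zero => exact torMem_of_subsingleton i _
  | succ k ih =>
    refine TorMem.middle (f := LinearMap.single R (fun _ : Fin (k + 1) => N) 0)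
      (g := LinearMap.funLeft R N Fin.succ) (Pi.single_injective (M := fun _ : Fin (k + 1) => N) 0)
      (LinearMap.funLeft_surjective_of_injective R N _ (Fin.succ_injective k)) ?_ h ih
    intro v
    constructor
    · intro hv
      refine ⟨v 0, funext fun j => ?_⟩
      refine Fin.cases (by simp) (fun j => ?_) j
      simpa using (congrFun hv j).symm
    · rintro ⟨a, rfl⟩
      ext j
      simp [LinearMap.funLeft]

theorem exists_surjective_fin_quotient {I : Ideal R} {N : Type u} [AddCommGroup N] [Module R N]
    [Module.Finite R N] (hI : ∀ a ∈ I, ∀ m : N, a • m = 0) :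
    ∃ (k : ℕ) (g : (Fin k → R ⧸ I) →ₗ[R] N), Function.Surjective g := by
  have ht : Module.IsTorsionBySet R N I := fun m a => hI a a.2 m
  let : Module (R ⧸ I) N := ht.module
  have : IsScalarTower R (R ⧸ I) N := ht.isScalarTower
  have : Module.Finite (R ⧸ I) N := Module.Finite.of_restrictScalars_finite R _ _
  obtain ⟨k, g, hg⟩ := Module.Finite.exists_fin' (R ⧸ I) N
  exact ⟨k, g.restrictScalars R, hg⟩

variable [IsNoetherianRing R]

/-- Dimension shifting: N is a quotient of some (R/I)^k, and the kernel is again finitely generated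
and killed by I. -/
theorem torMem_of_smul_eq_zero {I : Ideal R} {i : ℕ} (h : ∀ j ≤ i, TorMem S M j (R ⧸ I))
    {N : Type u} [AddCommGroup N] [Module R N] [Module.Finite R N]
    (hI : ∀ a ∈ I, ∀ m : N, a • m = 0) : TorMem S M i N := by
  induction i generalizing N with
  | zero =>
    obtain ⟨k, g, hg⟩ := exists_surjective_fin_quotient hI
    exact TorMem.right_zero hg (torMem_fin_fun (h 0 le_rfl) k)
  | succ i ih =>
    obtain ⟨k, g, hg⟩ := exists_surjective_fin_quotient hI
    refine TorMem.right_succ (LinearMap.ker g).subtype_injective hg g.exact_subtype_ker_map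
      (torMem_fin_fun (h _ le_rfl) k) (ih (fun j hj => h j (by omega)) fun a ha m => ?_)
    refine Subtype.ext (funext fun j => ?_)
    have := Ideal.Quotient.eq_zero_iff_mem.2 ha
    change a • (m.1 j) = 0
    rw [Algebra.smul_def, Ideal.Quotient.algebraMap_eq, this, zero_mul]

theorem torMem_of_pow_smul_eq_zero {I : Ideal R} {i : ℕ} (h : ∀ j ≤ i, TorMem S M j (R ⧸ I))
    (k : ℕ) {N : Type u} [AddCommGroup N] [Module R N] [Module.Finite R N]
    (hI : ∀ a ∈ I ^ k, ∀ m : N, a • m = 0) : TorMem S M i N := by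
  induction k generalizing N with
  | zero =>
    have : Subsingleton N := subsingleton_of_forall_eq 0 fun m => by
      simpa using hI 1 (by simp) m
    exact torMem_of_subsingleton i N
  | succ k ih =>
    -- I^k kills IN, and I kills N/IN.
    let L : Submodule R N := I • ⊤
    refine TorMem.middle L.subtype_injective L.mkQ_surjective
      (LinearMap.exact_subtype_mkQ L) (ih fun a ha m => ?_)
      (torMem_of_smul_eq_zero h fun a ha m => ?_)
    · obtain ⟨m, hm⟩ := m
      refine Subtype.ext ?_
      change a • m = 0
      refine Submodule.smul_induction_on (p := fun m => a • m = 0) hm (fun b hb n _ => ?_)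
        (fun x y hx hy => by rw [smul_add, hx, hy, add_zero])
      rw [smul_smul]
      exact hI _ (pow_succ I k ▸ Ideal.mul_mem_mul ha hb) n
    · obtain ⟨m, rfl⟩ := L.mkQ_surjective m
      rw [← map_smul]
      exact (Submodule.Quotient.mk_eq_zero L).2 (Submodule.smul_mem_smul ha trivial)

theorem torMem_quotient_of_radical_le {I J : Ideal R} (hIJ : I.radical ≤ J.radical) {i : ℕ}
    (h : ∀ j ≤ i, TorMem S M j (R ⧸ I)) : TorMem S M i (R ⧸ J) := by
  obtain ⟨k, hk⟩ := Ideal.exists_pow_le_of_le_radical_of_fg (Ideal.le_radical.trans hIJ)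
    (IsNoetherian.noetherian I)
  refine torMem_of_pow_smul_eq_zero h k fun a ha m => ?_
  rw [Algebra.smul_def, Ideal.Quotient.algebraMap_eq,
    Ideal.Quotient.eq_zero_iff_mem.2 (hk ha), zero_mul]

end Annihilated

/-! ### Complexes of flat modules with homology killed by I -/

section Complex

variable {R : Type u} [CommRing R] {S : ObjectProperty (ModuleCat.{u} R)} [S.IsSerreClass]
  {M : ModuleCat.{u} R}

theorem prop_ker_comp {A B C : Type u} [AddCommGroup A] [AddCommGroup B] [AddCommGroup C]
    [Module R A] [Module R B] [Module R C] {p : A →ₗ[R] B} {q : B →ₗ[R] C}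
    (hp : S (ModuleCat.of R (LinearMap.ker p))) (hq : S (ModuleCat.of R (LinearMap.ker q))) :
    S (ModuleCat.of R (LinearMap.ker (q ∘ₗ p))) := by
  refine prop_of_exact (f := Submodule.inclusion (LinearMap.ker_le_ker_comp p q))
    (g := p.restrict (p := LinearMap.ker (q ∘ₗ p)) (q := LinearMap.ker q) fun _ h => h) ?_ hp hq
  intro a
  constructor
  · intro h
    exact ⟨⟨a.1, congrArg Subtype.val h⟩, rfl⟩
  · rintro ⟨b, rfl⟩
    exact Subtype.ext b.2

theorem prop_ker_of_prop_ker_comp {A B C : Type u} [AddCommGroup A] [AddCommGroup B]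
    [AddCommGroup C] [Module R A] [Module R B] [Module R C] {p : A →ₗ[R] B} {q : B →ₗ[R] C}
    (hp : Function.Surjective p) (h : S (ModuleCat.of R (LinearMap.ker (q ∘ₗ p)))) :
    S (ModuleCat.of R (LinearMap.ker q)) := by
  refine prop_of_surjective
    (g := p.restrict (p := LinearMap.ker (q ∘ₗ p)) (q := LinearMap.ker q) fun _ h => h) ?_ h
  rintro ⟨b, hb⟩
  obtain ⟨a, rfl⟩ := hp b
  exact ⟨⟨a, hb⟩, rfl⟩

/-- By right exactness the kernel of p ⊗ M is a quotient of ker p ⊗ M. -/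
theorem prop_ker_rTensor {A B : Type u} [AddCommGroup A] [AddCommGroup B]
    [Module R A] [Module R B] {p : A →ₗ[R] B} (hp : Function.Surjective p)
    (h : TorMem S M 0 (LinearMap.ker p)) : S (ModuleCat.of R (LinearMap.ker (p.rTensor M))) := by
  have he : Function.Exact ((LinearMap.ker p).subtype.rTensor M) (p.rTensor M) :=
    rTensor_exact M p.exact_subtype_ker_map hp
  rw [torMem_zero_iff] at h
  rw [he.linearMap_ker_eq]
  exact prop_of_surjective (LinearMap.surjective_rangeRestrict _) h

variable {K : ℕ → Type u} [∀ n, AddCommGroup (K n)] [∀ n, Module R (K n)]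
  (d : ∀ n, K (n + 1) →ₗ[R] K n)

/-- The map `K_{n+1} / B_{n+1} → B_n` induced by the differential, whose kernel is `H_{n+1}`. -/
def toBoundaries (hd : ∀ n, d n ∘ₗ d (n + 1) = 0) (n : ℕ) :
    (K (n + 1) ⧸ LinearMap.range (d (n + 1))) →ₗ[R] LinearMap.range (d n) :=
  (LinearMap.range (d (n + 1))).liftQ (d n).rangeRestrict <| by
    rintro _ ⟨a, rfl⟩
    exact Subtype.ext (LinearMap.congr_fun (hd n) a)

variable {d} (hd : ∀ n, d n ∘ₗ d (n + 1) = 0)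

theorem toBoundaries_surjective (n : ℕ) : Function.Surjective (toBoundaries d hd n) := by
  rintro ⟨_, a, rfl⟩
  exact ⟨Submodule.Quotient.mk a, rfl⟩

theorem smul_ker_toBoundaries {I : Ideal R} {n : ℕ}
    (hI : ∀ a ∈ I, ∀ z, d n z = 0 → a • z ∈ LinearMap.range (d (n + 1)))
    (a : R) (ha : a ∈ I) (m : LinearMap.ker (toBoundaries d hd n)) : a • m = 0 := by
  obtain ⟨m, hm⟩ := m
  obtain ⟨z, rfl⟩ := Submodule.Quotient.mk_surjective _ m
  refine Subtype.ext ?_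
  exact (Submodule.Quotient.mk_eq_zero _).2 (hI a ha z (congrArg Subtype.val hm))

theorem torMem_one_boundaries_iff [∀ n, Module.Flat R (K n)] (n : ℕ) :
    TorMem S M 1 (K n ⧸ LinearMap.range (d n)) ↔
      S (ModuleCat.of R (LinearMap.ker ((LinearMap.range (d n)).subtype.rTensor M))) :=
  torMem_one_iff (Submodule.subtype_injective _) (Submodule.mkQ_surjective _)
    (LinearMap.exact_subtype_mkQ _)

variable (S M) in
/-- The assertion that `H_n(K ⊗ M)` belongs to `S`, in terms of the modules `K_n / B_n`. -/
def HomologyMem : ℕ → Prop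
  | 0 => TorMem S M 0 (K 0 ⧸ LinearMap.range (d 0))
  | n + 1 => S (ModuleCat.of R (LinearMap.ker
      (((LinearMap.range (d n)).subtype ∘ₗ toBoundaries d hd n).rTensor M)))

variable [∀ n, Module.Flat R (K n)]

theorem TorMem.of_homologyMem {n : ℕ} (h : HomologyMem S M hd (n + 1)) :
    TorMem S M 1 (K n ⧸ LinearMap.range (d n)) := by
  rw [torMem_one_boundaries_iff]
  rw [HomologyMem, LinearMap.rTensor_comp] at h
  exact prop_ker_of_prop_ker_comp
    (LinearMap.rTensor_surjective M (toBoundaries_surjective hd n)) h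

/-- C_{n+1} ⊗ M → K_n ⊗ M factors through B_n ⊗ M; the second factor has kernel Tor_1(C_n), the
first a quotient of H_{n+1} ⊗ M. -/
theorem HomologyMem.of_torMem {n : ℕ} (h : TorMem S M 1 (K n ⧸ LinearMap.range (d n)))
    (h' : TorMem S M 0 (LinearMap.ker (toBoundaries d hd n))) :
    HomologyMem S M hd (n + 1) := by
  rw [torMem_one_boundaries_iff] at h
  rw [HomologyMem, LinearMap.rTensor_comp]
  exact prop_ker_comp (prop_ker_rTensor (toBoundaries_surjective hd n) h') h

theorem TorMem.shift_up {n j : ℕ} (h : TorMem S M (j + 2) (K n ⧸ LinearMap.range (d n)))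
    (h' : TorMem S M (j + 1) (LinearMap.ker (toBoundaries d hd n))) :
    TorMem S M (j + 1) (K (n + 1) ⧸ LinearMap.range (d (n + 1))) :=
  TorMem.middle (Submodule.subtype_injective _) (toBoundaries_surjective hd n)
    (LinearMap.exact_subtype_ker_map _) h'
    (TorMem.left (Submodule.subtype_injective _) (Submodule.mkQ_surjective _)
      (LinearMap.exact_subtype_mkQ _) h (torMem_succ_of_flat j))

theorem TorMem.shift_down {n j : ℕ}
    (h : TorMem S M (j + 1) (K (n + 1) ⧸ LinearMap.range (d (n + 1))))
    (h' : TorMem S M j (LinearMap.ker (toBoundaries d hd n))) :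
    TorMem S M (j + 2) (K n ⧸ LinearMap.range (d n)) :=
  TorMem.right_succ (Submodule.subtype_injective _) (Submodule.mkQ_surjective _)
    (LinearMap.exact_subtype_mkQ _) (torMem_succ_of_flat (j + 1))
    (TorMem.right_succ (Submodule.subtype_injective _) (toBoundaries_surjective hd n)
      (LinearMap.exact_subtype_ker_map _) h h')

variable [IsNoetherianRing R] [∀ n, Module.Finite R (K n)] {I : Ideal R}
  (hI : ∀ n, ∀ a ∈ I, ∀ z, d n z = 0 → a • z ∈ LinearMap.range (d (n + 1)))
  (e : (K 0 ⧸ LinearMap.range (d 0)) ≃ₗ[R] R ⧸ I)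

include hI e

theorem homologyMem_of_torMem {n : ℕ} (h : ∀ i ≤ n, TorMem S M i (R ⧸ I)) :
    HomologyMem S M hd n := by
  have hker : ∀ i ≤ n, ∀ m, TorMem S M i (LinearMap.ker (toBoundaries d hd m)) :=
    fun i hi m => torMem_of_smul_eq_zero (fun j hj => h j (hj.trans hi))
      (smul_ker_toBoundaries hd (hI m))
  -- Each step up in m costs one Tor degree, starting from C_0 ≅ R/I.
  have key : ∀ m j, j + 1 + m ≤ n → TorMem S M (j + 1) (K m ⧸ LinearMap.range (d m)) := by
    intro m
    induction m with
    | zero => exact fun j hj => (h (j + 1) hj).congr e.symm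
    | succ m ih =>
      exact fun j hj => TorMem.shift_up hd (ih (j + 1) (by omega)) (hker _ (by omega) m)
  cases n with
  | zero => exact (h 0 le_rfl).congr e.symm
  | succ n => exact HomologyMem.of_torMem hd (key n 0 (by omega)) (hker 0 (by omega) n)

theorem torMem_of_homologyMem {n : ℕ} (h : ∀ i ≤ n, HomologyMem S M hd i) :
    TorMem S M n (R ⧸ I) := by
  induction n using Nat.strong_induction_on with
  | _ n ih =>
    cases n with
    | zero => exact TorMem.congr e (h 0 le_rfl)
    | succ n =>
      -- The induction hypothesis gives Tor_i(R/I) only for i ≤ n, which is all that the shifts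
      -- below require.
      have hker : ∀ i ≤ n, ∀ m, TorMem S M i (LinearMap.ker (toBoundaries d hd m)) :=
        fun i hi m => torMem_of_smul_eq_zero
          (fun j hj => ih j (by omega) fun k hk => h k (by omega))
          (smul_ker_toBoundaries hd (hI m))
      -- Descent along the diagonal from Tor_1(C_n), supplied by H_{n+1}(K ⊗ M), to Tor_{n+1}(C_0).
      have key : ∀ j m, j + m = n → TorMem S M (j + 1) (K m ⧸ LinearMap.range (d m)) := by
        intro j
        induction j with
        | zero =>
          rintro m hm
          obtain rfl : m = n := by omega
          exact TorMem.of_homologyMem hd (h (m + 1) le_rfl)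
        | succ j ihj =>
          exact fun m hm =>
            TorMem.shift_down hd (ihj (m + 1) (by omega)) (hker j (by omega) m)
      exact (key n 0 rfl).congr e

end Complex

/-! ### Application to the Koszul complex -/

section KoszulComplex

variable {R : Type u} [CommRing R]

theorem range_form {r : ℕ} (x : Fin r → R) :
    LinearMap.range (form x) = Ideal.span (Set.range x) :=
  Fintype.range_linearCombination R x

/-- Contraction is an antiderivation: d(v ∧ z) = f(v) z − v ∧ dz with f = `form x`. For a cycle z
and a = f(v), this exhibits a z as a boundary. -/
theorem smul_mem_range_differential {r : ℕ} (x : Fin r → R) (n : ℕ) (a : R)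
    (ha : a ∈ Ideal.span (Set.range x)) (z : ⋀[R]^(n + 1) (Fin r → R))
    (hz : differential x n z = 0) : a • z ∈ LinearMap.range (differential x (n + 1)) := by
  rw [← range_form] at ha
  obtain ⟨v, rfl⟩ := ha
  have hmem : ExteriorAlgebra.ι R v * (z : ExteriorAlgebra R (Fin r → R)) ∈
      ⋀[R]^(n + 1 + 1) (Fin r → R) := by
    have h : ⋀[R]^(n + 1 + 1) (Fin r → R)
        = LinearMap.range (ExteriorAlgebra.ι R) * ⋀[R]^(n + 1) (Fin r → R) := pow_succ' _ _
    rw [h]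
    exact Submodule.mul_mem_mul (LinearMap.mem_range_self _ v) z.2
  have hz' : CliffordAlgebra.contractLeft (Q := (0 : QuadraticForm R (Fin r → R))) (form x)
      (z : ExteriorAlgebra R (Fin r → R)) = 0 := congrArg Subtype.val hz
  refine ⟨⟨_, hmem⟩, Subtype.ext ?_⟩
  have h := CliffordAlgebra.contractLeft_ι_mul (Q := (0 : QuadraticForm R (Fin r → R)))
    (d := form x) v (z : ExteriorAlgebra R (Fin r → R))
  rw [hz', mul_zero, sub_zero] at h
  exact h

theorem zeroEquiv_algebraMap {E : Type u} [AddCommGroup E] [Module R E] (a : R)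
    (z : ⋀[R]^0 E) (hz : (z : ExteriorAlgebra R E) = algebraMap R _ a) :
    exteriorPower.zeroEquiv R E z = a := by
  have h : z = a • exteriorPower.ιMulti R 0 (Fin.elim0 : Fin 0 → E) := by
    refine Subtype.ext ?_
    rw [hz, Algebra.algebraMap_eq_smul_one]
    simp
  rw [h, map_smul, exteriorPower.zeroEquiv_ιMulti, smul_eq_mul, mul_one]

theorem zeroEquiv_differential {r : ℕ} (x : Fin r → R) (v : Fin r → R)
    (z : ⋀[R]^(0 + 1) (Fin r → R))
    (hz : (z : ExteriorAlgebra R (Fin r → R)) = ExteriorAlgebra.ι R v) :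
    exteriorPower.zeroEquiv R (Fin r → R) (differential x 0 z) = form x v := by
  refine zeroEquiv_algebraMap _ _ ?_
  have h := CliffordAlgebra.contractLeft_ι (Q := (0 : QuadraticForm R (Fin r → R)))
    (d := form x) v
  change CliffordAlgebra.contractLeft (Q := (0 : QuadraticForm R (Fin r → R))) (form x)
    (z : ExteriorAlgebra R (Fin r → R)) = _
  rw [hz]
  exact h

theorem map_range_differential_zero {r : ℕ} (x : Fin r → R) :
    (LinearMap.range (differential x 0)).map
      (exteriorPower.zeroEquiv R (Fin r → R)).toLinearMap = Ideal.span (Set.range x) := by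
  have h : ⋀[R]^(0 + 1) (Fin r → R) = LinearMap.range (ExteriorAlgebra.ι R) := by
    rw [zero_add]; exact pow_one _
  rw [← range_form]
  ext a
  constructor
  · rintro ⟨_, ⟨z, rfl⟩, rfl⟩
    obtain ⟨v, hv⟩ := h.le z.2
    exact ⟨v, (zeroEquiv_differential x v z hv.symm).symm⟩
  · rintro ⟨v, rfl⟩
    exact ⟨_, ⟨⟨ExteriorAlgebra.ι R v, h.ge (LinearMap.mem_range_self _ v)⟩, rfl⟩,
      zeroEquiv_differential x v _ rfl⟩

/-- The cokernel of the last Koszul differential is `R / (x_1, …, x_r)`. -/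
noncomputable def quotientRangeEquiv {r : ℕ} (x : Fin r → R) :
    (⋀[R]^0 (Fin r → R) ⧸ LinearMap.range (differential x 0)) ≃ₗ[R]
      R ⧸ Ideal.span (Set.range x) :=
  Submodule.Quotient.equiv _ _ (exteriorPower.zeroEquiv R (Fin r → R))
    (map_range_differential_zero x)

variable {S : ObjectProperty (ModuleCat.{u} R)} [S.IsSerreClass] {M : ModuleCat.{u} R}

/-- Q is the cokernel of `T.f`, and homology is the kernel of the map from that cokernel to `T.X₃`.
-/
theorem prop_homology_iff (T : ShortComplex (ModuleCat.{u} R)) {Q : Type u} [AddCommGroup Q]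
    [Module R Q] (p : T.X₂ →ₗ[R] Q) (q : Q →ₗ[R] T.X₃) (hp : Function.Surjective p)
    (hf : Function.Exact T.f.hom p) (hq : q ∘ₗ p = T.g.hom) :
    S T.homology ↔ S (ModuleCat.of R (LinearMap.ker q)) := by
  let p' : LinearMap.ker T.g.hom →ₗ[R] LinearMap.ker q :=
    p.restrict fun a ha => by rwa [← hq] at ha
  have hp' : Function.Surjective p' := by
    rintro ⟨b, hb⟩
    obtain ⟨a, rfl⟩ := hp b
    exact ⟨⟨a, by rw [← hq]; exact hb⟩, rfl⟩
  have hker : LinearMap.range T.moduleCatToCycles = LinearMap.ker p' := by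
    ext ⟨a, ha⟩
    constructor
    · rintro ⟨b, hb⟩
      exact Subtype.ext ((hf a).2 ⟨b, congrArg Subtype.val hb⟩)
    · intro h
      obtain ⟨b, hb⟩ := (hf a).1 (congrArg Subtype.val h)
      exact ⟨b, Subtype.ext hb⟩
  exact S.prop_iff_of_iso (T.moduleCatHomologyIso ≪≫
    ((Submodule.quotEquivOfEq _ _ hker).trans (p'.quotKerEquivOfSurjective hp')).toModuleIso)

theorem tensorComplex_d {r : ℕ} (x : Fin r → R) (M : ModuleCat.{u} R) (n : ℕ) :
    ((tensorComplex x M).d (n + 1) n).hom = (differential x n).rTensor M := by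
  have h : (koszulComplex x).d (n + 1) n = ModuleCat.ofHom (differential x n) :=
    ChainComplex.of_d (fun n => ModuleCat.of R (⋀[R]^n (Fin r → R)))
      (fun n => ModuleCat.ofHom (differential x n)) n
  change ((MonoidalCategory.tensorRight M).map ((koszulComplex x).d (n + 1) n)).hom = _
  rw [h]
  rfl

theorem exact_rTensor_mkQ {A B : Type u} [AddCommGroup A] [AddCommGroup B] [Module R A]
    [Module R B] (f : A →ₗ[R] B) :
    Function.Exact (f.rTensor M) ((LinearMap.range f).mkQ.rTensor M) :=
  rTensor_exact M (LinearMap.exact_map_mkQ_range f) (Submodule.mkQ_surjective _)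

theorem koszulHomology_iff {r : ℕ} (x : Fin r → R) (n : ℕ) :
    S (koszulHomology x M n) ↔ HomologyMem S M (K := fun n => ⋀[R]^n (Fin r → R))
      (d := differential x) (differential_comp x) n := by
  cases n with
  | zero =>
    rw [koszulHomology, HomologyMem, torMem_zero_iff,
      S.prop_iff_of_iso ((tensorComplex x M).homologyIsoSc' 1 0 0 (by simp) (by simp))]
    -- No degree follows 0, so the third term defaults to degree 0 with zero differential; hence q =
    -- 0.
    rw [prop_homology_iff (S := S) ((tensorComplex x M).sc' 1 0 0)
      ((LinearMap.range (differential x 0)).mkQ.rTensor M) 0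
      (LinearMap.rTensor_surjective M (Submodule.mkQ_surjective _)) ?_ ?_]
    · rw [LinearMap.ker_zero]
      exact S.prop_iff_of_iso (LinearEquiv.toModuleIso Submodule.topEquiv)
    · change Function.Exact ((tensorComplex x M).d (0 + 1) 0).hom _
      rw [tensorComplex_d]
      exact exact_rTensor_mkQ _
    · change _ = ((tensorComplex x M).d 0 0).hom
      rw [(tensorComplex x M).shape 0 0 (by simp)]
      exact LinearMap.zero_comp _
  | succ n =>
    rw [koszulHomology, HomologyMem, S.prop_iff_of_iso
      ((tensorComplex x M).homologyIsoSc' (n + 2) (n + 1) n (by simp) (by simp))]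
    refine prop_homology_iff ((tensorComplex x M).sc' (n + 2) (n + 1) n)
      ((LinearMap.range (differential x (n + 1))).mkQ.rTensor M)
      (((LinearMap.range (differential x n)).subtype ∘ₗ
        toBoundaries (K := fun n => ⋀[R]^n (Fin r → R)) (differential x) (differential_comp x) n).rTensor M)
      (LinearMap.rTensor_surjective M (Submodule.mkQ_surjective _)) ?_ ?_
    · change Function.Exact ((tensorComplex x M).d (n + 1 + 1) (n + 1)).hom _
      rw [tensorComplex_d]
      exact exact_rTensor_mkQ _
    · change _ = ((tensorComplex x M).d (n + 1) n).hom
      rw [tensorComplex_d]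
      exact (LinearMap.rTensor_comp M _ _).symm

theorem forall_koszulHomology_iff [IsNoetherianRing R] {r : ℕ} (x : Fin r → R) (n : ℕ) :
    (∀ i ≤ n, S (koszulHomology x M i)) ↔
      ∀ i ≤ n, TorMem S M i (R ⧸ Ideal.span (Set.range x)) := by
  simp only [koszulHomology_iff]
  constructor
  · exact fun h i hi => torMem_of_homologyMem (K := fun n => ⋀[R]^n (Fin r → R)) (d := differential x)
      (differential_comp x) (smul_mem_range_differential x)
      (quotientRangeEquiv x) fun j hj => h j (hj.trans hi)
  · exact fun h i hi => homologyMem_of_torMem (K := fun n => ⋀[R]^n (Fin r → R)) (d := differential x)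
      (differential_comp x) (smul_mem_range_differential x)
      (quotientRangeEquiv x) fun j hj => h j (hj.trans hi)

end KoszulComplex

end Koszul

theorem mainTheorem5 (R : Type u) [CommRing R] [IsNoetherianRing R]
    (S : ObjectProperty (ModuleCat.{u} R)) [S.IsSerreClass]
    (M : ModuleCat.{u} R) (I J : Ideal R) (hIJ : I.radical = J.radical)
    {r : ℕ} (x : Fin r → R) (hx : Ideal.span (Set.range x) = I)
    {s : ℕ} (y : Fin s → R) (hy : Ideal.span (Set.range y) = J)
    (n : ℕ) :
    List.TFAE [
      ∀ i ≤ n, S (((Tor (ModuleCat.{u} R) i).obj (ModuleCat.of R (R ⧸ I))).obj M),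
      ∀ i ≤ n, S (((Tor (ModuleCat.{u} R) i).obj (ModuleCat.of R (R ⧸ J))).obj M),
      ∀ i ≤ n, S (Koszul.koszulHomology x M i),
      ∀ i ≤ n, S (Koszul.koszulHomology y M i)] := by
  subst hx hy
  tfae_have 1 → 2 := fun h i hi =>
    Koszul.torMem_quotient_of_radical_le hIJ.le fun j hj => h j (hj.trans hi)
  tfae_have 2 → 1 := fun h i hi =>
    Koszul.torMem_quotient_of_radical_le hIJ.ge fun j hj => h j (hj.trans hi)
  tfae_have 3 ↔ 1 := Koszul.forall_koszulHomology_iff x n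
  tfae_have 4 ↔ 2 := Koszul.forall_koszulHomology_iff y n
  tfae_finish
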